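/- Let $d=p^m$ be a power of a prime ($p$ prime, $m\ge 1$), and let $dU$ denote the Haar probability measure on the unitary group $U(d^2)$ of the Hilbert space $\mathbb{C}^d\otimes\mathbb{C}^d$ of dimension $d^2$. Write $\operatorname{tr}_B$ for the partial trace over the second tensor factor, and for a Hermitian $d\times d$ matrix $\sigma$ let $\operatorname{tr}(\sigma^2)=\|\sigma\|_2^2$ be its purity. Then the average purity of the reduced state of a random pure state on $\mathbb{C}^d\otimes\mathbb{C}^d$ is $2d/(d^2+1)$; that is, for every unit vector $\psi\in\mathbb{C}^d\otimes\mathbb{C}^d$ the function $U\mapsto \operatorname{tr}\big[\big(\operatorname{tr}_B[\,U|\psi\rangle\langle\psi|U^\dagger\,]\big)^2\big]$ is integrable on $U(d^2)$ and $$\int_{U(d^2)} \operatorname{tr}\Big[\big(\operatorname{tr}_B[\,U|\psi\rangle\langle\psi|U^\dagger\,]\big)^2\Big]\,dU=\frac{2d}{d^2+1}.$$ -/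

import Mathlib

open MeasureTheory

/-- The unitary group `U(n)`, as a closed bounded set of matrices, is compact. -/
theorem unitaryGroup_isCompact (n : Type) [Fintype n] [DecidableEq n] :
    IsCompact (Matrix.unitaryGroup n ℂ : Set (Matrix n n ℂ)) := by
  have hK : IsCompact (Set.univ.pi fun _ : n => Set.univ.pi fun _ : n =>
      Metric.closedBall (0 : ℂ) 1) :=
    isCompact_univ_pi fun _ => isCompact_univ_pi fun _ => isCompact_closedBall 0 1
  refine hK.of_isClosed_subset ?_ ?_
  · have : (Matrix.unitaryGroup n ℂ : Set (Matrix n n ℂ)) =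
        {A : Matrix n n ℂ | A * star A = 1} := by
      ext A
      exact Matrix.mem_unitaryGroup_iff
    rw [this]
    exact isClosed_eq (by fun_prop) continuous_const
  · intro A hA i _ j _
    simpa using entry_norm_bound_of_unitary hA i j

instance unitaryGroup_compactSpace (n : Type) [Fintype n] [DecidableEq n] :
    CompactSpace (Matrix.unitaryGroup n ℂ) :=
  isCompact_iff_compactSpace.mp (unitaryGroup_isCompact n)

/-- The unitary group carries its Borel `σ`-algebra. -/
noncomputable instance unitaryGroup_measurableSpace (n : Type) [Fintype n] [DecidableEq n] :
    MeasurableSpace (Matrix.unitaryGroup n ℂ) :=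
  borel _

instance unitaryGroup_borelSpace (n : Type) [Fintype n] [DecidableEq n] :
    BorelSpace (Matrix.unitaryGroup n ℂ) :=
  ⟨rfl⟩

/-- The Haar measure of the unitary group `U(n)`, normalized to total mass one. -/
noncomputable def unitaryHaar (n : Type) [Fintype n] [DecidableEq n] :
    Measure (Matrix.unitaryGroup n ℂ) :=
  Measure.haarMeasure (⊤ : TopologicalSpace.PositiveCompacts (Matrix.unitaryGroup n ℂ))

instance unitaryHaar_isHaarMeasure (n : Type) [Fintype n] [DecidableEq n] :
    (unitaryHaar n).IsHaarMeasure :=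
  Measure.isHaarMeasure_haarMeasure _

instance unitaryHaar_isProbabilityMeasure (n : Type) [Fintype n] [DecidableEq n] :
    IsProbabilityMeasure (unitaryHaar n) :=
  ⟨by simpa [unitaryHaar] using
    Measure.haarMeasure_self (K₀ := (⊤ : TopologicalSpace.PositiveCompacts
      (Matrix.unitaryGroup n ℂ)))⟩

/-- The rank-one operator `|ψ⟩⟨ψ|`. -/
def ketBra {n : Type} (ψ : EuclideanSpace ℂ n) : Matrix n n ℂ :=
  Matrix.of fun x y => ψ x * star (ψ y)

/-- The partial trace `tr_B` over the second tensor factor. The space `ℂ^d ⊗ ℂ^d` has the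
coordinates `Fin d × Fin d`, the pair `(i, j)` standing for `|i⟩ ⊗ |j⟩`. -/
def partialTraceB {d : ℕ} (ρ : Matrix (Fin d × Fin d) (Fin d × Fin d) ℂ) :
    Matrix (Fin d) (Fin d) ℂ :=
  Matrix.of fun i i' => ∑ j, ρ (i, j) (i', j)

/-- The purity `tr (ρ²)`; for a Hermitian `ρ` this trace is real, see `ofReal_purity`. -/
def purity {d : ℕ} (ρ : Matrix (Fin d) (Fin d) ℂ) : ℝ :=
  (ρ ^ 2).trace.re

theorem ofReal_purity {d : ℕ} {ρ : Matrix (Fin d) (Fin d) ℂ} (hρ : ρ.IsHermitian) :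
    (purity ρ : ℂ) = (ρ ^ 2).trace := by
  apply Complex.conj_eq_iff_re.mp
  have h : (ρ ^ 2).IsHermitian := hρ.pow 2
  have := Matrix.trace_conjTranspose (ρ ^ 2)
  rw [h.eq] at this
  exact this.symm

/-- For a Hermitian `ρ`, the purity is the squared Hilbert–Schmidt norm. -/
theorem purity_eq_sum {d : ℕ} {ρ : Matrix (Fin d) (Fin d) ℂ} (hρ : ρ.IsHermitian) :
    purity ρ = ∑ i, ∑ j, ‖ρ i j‖ ^ 2 := by
  have h : ∀ i j, ρ i j * ρ j i = ((‖ρ i j‖ ^ 2 : ℝ) : ℂ) := fun i j => by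
    rw [← hρ.apply j i]
    simpa using Complex.mul_conj' (ρ i j)
  simp only [purity, pow_two ρ, Matrix.trace, Matrix.diag, Matrix.mul_apply, h]
  simp only [← Complex.ofReal_sum, Complex.ofReal_re]


/-!
The distribution of `U ψ` for Haar random `U` is invariant under every unitary, and this alone
determines its moments `E[v_a v_b v̄_c v̄_e]` up to one constant. Diagonal phases kill the moment
unless `{a, b} = {c, e}` as multisets, permutations make `E|v_a|⁴` independent of `a`, and a square
root of the transposition `(a b)` gives `E|v_a|²|v_b|² = E|v_a|⁴ / 2` for `a ≠ b`. The constant is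
fixed by `E‖v‖⁴ = ‖ψ‖⁴`. The purity of the reduced state is a quartic form of this kind in `v`.
-/

open Matrix

section UnitarilyInvariantMeasure

variable {n : Type*}

/-- The moment `E[v_a v_b v̄_c v̄_e]` of a random vector `v` with distribution `μ`. -/
noncomputable def fourthMoment (μ : Measure (EuclideanSpace ℂ n)) (a b c e : n) : ℂ :=
  ∫ v, v a * v b * star (v c) * star (v e) ∂μ

theorem fourthMoment_swap_right (μ : Measure (EuclideanSpace ℂ n)) (a b c e : n) :
    fourthMoment μ a b c e = fourthMoment μ a b e c :=
  integral_congr_ae (.of_forall fun _ => mul_right_comm ..)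

variable [Fintype n]

theorem integrable_fourth_monomial {μ : Measure (EuclideanSpace ℂ n)}
    (hint : Integrable (fun v => ‖v‖ ^ 4) μ) (a b c e : n) :
    Integrable (fun v => v a * v b * star (v c) * star (v e)) μ := by
  refine hint.mono' (by fun_prop) (.of_forall fun v => ?_)
  have hle (x : n) : ‖v x‖ ≤ ‖v‖ := PiLp.norm_apply_le v x
  calc ‖v a * v b * star (v c) * star (v e)‖ = ‖v a‖ * ‖v b‖ * ‖v c‖ * ‖v e‖ := by
        simp only [norm_mul, norm_star]
    _ ≤ ‖v‖ * ‖v‖ * ‖v‖ * ‖v‖ := by gcongr <;> exact hle _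
    _ = ‖v‖ ^ 4 := by ring

theorem norm_pow_four_eq_sum (v : EuclideanSpace ℂ n) :
    ((‖v‖ ^ 4 : ℝ) : ℂ) = ∑ p : n × n, v p.1 * v p.2 * star (v p.1) * star (v p.2) := by
  have hsq : ((‖v‖ ^ 2 : ℝ) : ℂ) = ∑ x, v x * star (v x) := by
    simp [EuclideanSpace.norm_sq_eq, Complex.mul_conj']
  calc ((‖v‖ ^ 4 : ℝ) : ℂ) = ((‖v‖ ^ 2 : ℝ) : ℂ) * ((‖v‖ ^ 2 : ℝ) : ℂ) := by push_cast; ring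
    _ = ∑ p : n × n, v p.1 * star (v p.1) * (v p.2 * star (v p.2)) := by
        rw [hsq, Finset.sum_mul_sum, Fintype.sum_prod_type]
    _ = ∑ p : n × n, v p.1 * v p.2 * star (v p.1) * star (v p.2) :=
        Finset.sum_congr rfl fun p _ => by ring

theorem sum_fourthMoment {μ : Measure (EuclideanSpace ℂ n)}
    (hint : Integrable (fun v => ‖v‖ ^ 4) μ) :
    ∑ p : n × n, fourthMoment μ p.1 p.2 p.1 p.2 = ((∫ v, ‖v‖ ^ 4 ∂μ : ℝ) : ℂ) := by
  rw [← integral_complex_ofReal]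
  simp only [norm_pow_four_eq_sum, fourthMoment]
  exact (integral_finsetSum _ fun p _ => integrable_fourth_monomial hint p.1 p.2 p.1 p.2).symm

variable [DecidableEq n]

theorem norm_toEuclideanCLM_of_mem_unitaryGroup {V : Matrix n n ℂ} (hV : V ∈ unitaryGroup n ℂ)
    (v : EuclideanSpace ℂ n) : ‖toEuclideanCLM (𝕜 := ℂ) V v‖ = ‖v‖ :=
  ContinuousLinearMap.norm_map_of_mem_unitary (Unitary.map_mem toEuclideanCLM hV) v

theorem measurableEmbedding_toEuclideanCLM {V : Matrix n n ℂ} (hV : V ∈ unitaryGroup n ℂ) :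
    MeasurableEmbedding (toEuclideanCLM (𝕜 := ℂ) V) :=
  (AddMonoidHomClass.isometry_of_norm _
    (norm_toEuclideanCLM_of_mem_unitaryGroup hV)).isClosedEmbedding.measurableEmbedding

theorem diagonal_mem_unitaryGroup {θ : n → ℂ} (hθ : ∀ x, θ x ∈ unitary ℂ) :
    diagonal θ ∈ unitaryGroup n ℂ := by
  rw [mem_unitaryGroup_iff, star_eq_conjTranspose, diagonal_conjTranspose, diagonal_mul_diagonal,
    ← diagonal_one]
  exact congrArg diagonal (funext fun x => Unitary.mul_star_self_of_mem (hθ x))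

theorem permMatrix_mem_unitaryGroup (σ : Equiv.Perm n) :
    σ.permMatrix ℂ ∈ unitaryGroup n ℂ := by
  rw [mem_unitaryGroup_iff, star_eq_conjTranspose, conjTranspose_permMatrix, ← permMatrix_mul,
    inv_mul_cancel, permMatrix_one]

/-- The matrix `((1 + i) 1 + (1 - i) P) / 2`, where `P` is the matrix of the transposition `(a b)`.
It is a square root of `P`. -/
noncomputable def sqrtSwapMatrix (a b : n) : Matrix n n ℂ :=
  ((1 + Complex.I) / 2) • 1 + ((1 - Complex.I) / 2) • (Equiv.swap a b).permMatrix ℂ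

theorem sqrtSwapMatrix_mem_unitaryGroup (a b : n) : sqrtSwapMatrix a b ∈ unitaryGroup n ℂ := by
  have hPP : (Equiv.swap a b).permMatrix ℂ * (Equiv.swap a b).permMatrix ℂ = 1 := by
    rw [← permMatrix_mul, Equiv.swap_mul_self, permMatrix_one]
  rw [mem_unitaryGroup_iff, sqrtSwapMatrix, star_eq_conjTranspose, conjTranspose_add,
    conjTranspose_smul, conjTranspose_smul, conjTranspose_one, conjTranspose_permMatrix,
    Equiv.swap_inv]
  simp only [add_mul, mul_add, smul_mul_smul_comm, hPP, mul_one, one_mul]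
  match_scalars <;> norm_num [Complex.ext_iff]

theorem sqrtSwapMatrix_mul_apply (a b : n) (v : EuclideanSpace ℂ n) :
    toEuclideanCLM (𝕜 := ℂ) (sqrtSwapMatrix a b) v a *
      toEuclideanCLM (𝕜 := ℂ) (sqrtSwapMatrix a b) v b = (v a ^ 2 + v b ^ 2) / 2 := by
  simp only [ofLp_toEuclideanCLM, sqrtSwapMatrix, add_mulVec, smul_mulVec, one_mulVec,
    permMatrix_mulVec, Pi.add_apply, Pi.smul_apply, Function.comp_apply, Equiv.swap_apply_left,
    Equiv.swap_apply_right, smul_eq_mul]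
  linear_combination (-(v a ^ 2 + v b ^ 2) / 4 + v a * v b / 2) * Complex.I_sq

/-- Invariance of a measure on `ℂⁿ` under the standard action of the unitary group. -/
def IsUnitarilyInvariant (μ : Measure (EuclideanSpace ℂ n)) : Prop :=
  ∀ V ∈ unitaryGroup n ℂ, MeasurePreserving (toEuclideanCLM (𝕜 := ℂ) V) μ μ

namespace IsUnitarilyInvariant

variable {μ : Measure (EuclideanSpace ℂ n)}

theorem integral_comp (hμ : IsUnitarilyInvariant μ) {V : Matrix n n ℂ}
    (hV : V ∈ unitaryGroup n ℂ) (f : EuclideanSpace ℂ n → ℂ) :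
    ∫ v, f (toEuclideanCLM (𝕜 := ℂ) V v) ∂μ = ∫ v, f v ∂μ :=
  (hμ V hV).integral_comp (measurableEmbedding_toEuclideanCLM hV) f

theorem fourthMoment_phase (hμ : IsUnitarilyInvariant μ) {θ : n → ℂ} (hθ : ∀ x, θ x ∈ unitary ℂ)
    (a b c e : n) :
    θ a * θ b * star (θ c) * star (θ e) * fourthMoment μ a b c e = fourthMoment μ a b c e := by
  have h := hμ.integral_comp (diagonal_mem_unitaryGroup hθ)
    fun v => v a * v b * star (v c) * star (v e)
  simp only [ofLp_toEuclideanCLM, mulVec_diagonal, star_mul'] at h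
  rw [fourthMoment, ← integral_const_mul, ← h]
  exact integral_congr_ae (.of_forall fun _ => by ring)

theorem fourthMoment_perm (hμ : IsUnitarilyInvariant μ) (σ : Equiv.Perm n) (a b c e : n) :
    fourthMoment μ (σ a) (σ b) (σ c) (σ e) = fourthMoment μ a b c e := by
  simpa [fourthMoment, permMatrix_mulVec] using hμ.integral_comp (permMatrix_mem_unitaryGroup σ)
    fun v => v a * v b * star (v c) * star (v e)

theorem fourthMoment_self_eq (hμ : IsUnitarilyInvariant μ) (a b : n) :
    fourthMoment μ a a a a = fourthMoment μ b b b b := by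
  simpa using (hμ.fourthMoment_perm (Equiv.swap a b) a a a a).symm

theorem fourthMoment_eq_zero_of_phase_ne_one (hμ : IsUnitarilyInvariant μ) {θ : n → ℂ}
    (hθ : ∀ x, θ x ∈ unitary ℂ) {a b c e : n} (h : θ a * θ b * star (θ c) * star (θ e) ≠ 1) :
    fourthMoment μ a b c e = 0 := by
  by_contra hne
  exact h (mul_right_cancel₀ hne ((hμ.fourthMoment_phase hθ a b c e).trans (one_mul _).symm))

theorem fourthMoment_eq_zero (hμ : IsUnitarilyInvariant μ) {a b c e : n}
    (h₁ : a = c → b ≠ e) (h₂ : a = e → b ≠ c) : fourthMoment μ a b c e = 0 := by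
  have hθ (x y : n) : Function.update (1 : n → ℂ) x Complex.I y ∈ unitary ℂ := by
    rcases eq_or_ne y x with rfl | hy <;> simp [Unitary.mem_iff, *]
  have hI : Complex.I ≠ 1 := by simp [Complex.ext_iff]
  have hneg : (-1 : ℂ) ≠ 1 := by norm_num
  -- Rotate a coordinate that has different degrees in `v_a v_b` and in `v_c v_e`.
  by_cases ha : a ≠ c ∧ a ≠ e
  · apply hμ.fourthMoment_eq_zero_of_phase_ne_one (hθ a)
    by_cases hab : b = a <;> simp [hab, ha.1.symm, ha.2.symm, hI, hneg]
  · apply hμ.fourthMoment_eq_zero_of_phase_ne_one (hθ b)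
    simp only [Function.update_apply, Pi.one_apply]
    split_ifs <;> simp_all

theorem fourthMoment_pair_of_ne (hμ : IsUnitarilyInvariant μ)
    (hint : Integrable (fun v => ‖v‖ ^ 4) μ) {a b : n} (hab : a ≠ b) :
    fourthMoment μ a b a b = fourthMoment μ a a a a / 2 := by
  have hm := integrable_fourth_monomial hint
  have hexpand (v : EuclideanSpace ℂ n) :
      (v a ^ 2 + v b ^ 2) / 2 * star ((v a ^ 2 + v b ^ 2) / 2) =
        (v a * v a * star (v a) * star (v a) + v b * v b * star (v b) * star (v b) +
          (v a * v a * star (v b) * star (v b) + v b * v b * star (v a) * star (v a))) / 4 := by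
    simp only [Complex.star_def, map_div₀, map_add, map_pow, map_ofNat]
    ring
  calc fourthMoment μ a b a b
      = ∫ v, (v a ^ 2 + v b ^ 2) / 2 * star ((v a ^ 2 + v b ^ 2) / 2) ∂μ := by
        simp only [← sqrtSwapMatrix_mul_apply, star_mul', ← mul_assoc]
        exact (hμ.integral_comp (sqrtSwapMatrix_mem_unitaryGroup a b)
          fun v => v a * v b * star (v a) * star (v b)).symm
    _ = (fourthMoment μ a a a a + fourthMoment μ b b b b +
          (fourthMoment μ a a b b + fourthMoment μ b b a a)) / 4 := by
        simp only [hexpand, fourthMoment]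
        rw [integral_div, integral_add (by fun_prop) (by fun_prop), integral_add (hm ..) (hm ..),
          integral_add (hm ..) (hm ..)]
    _ = fourthMoment μ a a a a / 2 := by
        rw [hμ.fourthMoment_eq_zero (a := a) (c := b) (absurd · hab) (absurd · hab),
          hμ.fourthMoment_eq_zero (a := b) (c := a) (absurd · hab.symm) (absurd · hab.symm),
          hμ.fourthMoment_self_eq b a]
        ring

theorem fourthMoment_pair_eq_mul_self (hμ : IsUnitarilyInvariant μ)
    (hint : Integrable (fun v => ‖v‖ ^ 4) μ) (a b x : n) :
    fourthMoment μ a b a b = fourthMoment μ x x x x / 2 * (1 + if a = b then 1 else 0) := by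
  rw [hμ.fourthMoment_self_eq x a]
  split_ifs with hab
  · subst hab
    ring
  · rw [hμ.fourthMoment_pair_of_ne hint hab]
    ring

theorem fourthMoment_self (hμ : IsUnitarilyInvariant μ)
    (hint : Integrable (fun v => ‖v‖ ^ 4) μ) (x : n) :
    fourthMoment μ x x x x =
      2 * ((∫ v, ‖v‖ ^ 4 ∂μ : ℝ) : ℂ) / (Fintype.card n * (Fintype.card n + 1)) := by
  have hsum : fourthMoment μ x x x x / 2 * (Fintype.card n * Fintype.card n + Fintype.card n) =
      ((∫ v, ‖v‖ ^ 4 ∂μ : ℝ) : ℂ) := by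
    rw [← sum_fourthMoment hint, Finset.sum_congr rfl fun p _ =>
      hμ.fourthMoment_pair_eq_mul_self hint p.1 p.2 x,
      ← Finset.mul_sum, Fintype.sum_prod_type]
    simp [Finset.sum_add_distrib]
  have : Nonempty n := ⟨x⟩
  have hcard : (Fintype.card n : ℂ) ≠ 0 := Nat.cast_ne_zero.mpr Fintype.card_ne_zero
  have hcard' : (Fintype.card n : ℂ) + 1 ≠ 0 := Nat.cast_add_one_ne_zero _
  rw [← hsum]
  field_simp

theorem fourthMoment_eq (hμ : IsUnitarilyInvariant μ)
    (hint : Integrable (fun v => ‖v‖ ^ 4) μ) (a b c e : n) :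
    fourthMoment μ a b c e =
      ((∫ v, ‖v‖ ^ 4 ∂μ : ℝ) : ℂ) / (Fintype.card n * (Fintype.card n + 1)) *
        ((if a = c ∧ b = e then 1 else 0) + if a = e ∧ b = c then 1 else 0) := by
  have hpair (x y : n) : fourthMoment μ x y x y =
      ((∫ v, ‖v‖ ^ 4 ∂μ : ℝ) : ℂ) / (Fintype.card n * (Fintype.card n + 1)) *
        (1 + if x = y then 1 else 0) := by
    rw [hμ.fourthMoment_pair_eq_mul_self hint x y x, hμ.fourthMoment_self hint]
    ring
  by_cases h₁ : a = c ∧ b = e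
  · obtain ⟨rfl, rfl⟩ := h₁
    have hsymm : a = b ∧ b = a ↔ a = b := and_iff_left_of_imp Eq.symm
    simp only [hpair, hsymm, and_self, if_true]
  by_cases h₂ : a = e ∧ b = c
  · obtain ⟨rfl, rfl⟩ := h₂
    have hab : a ≠ b := fun h => h₁ ⟨h, h.symm⟩
    simp [fourthMoment_swap_right μ a b b a, hpair, hab]
  · simp [h₁, h₂, hμ.fourthMoment_eq_zero (not_and.mp h₁) (not_and.mp h₂)]

end IsUnitarilyInvariant

end UnitarilyInvariantMeasure

section HaarOrbit

variable {n : Type} [Fintype n] [DecidableEq n]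

/-- The distribution of `U ψ` for a Haar random unitary `U`. -/
noncomputable def haarOrbitMeasure (ψ : EuclideanSpace ℂ n) : Measure (EuclideanSpace ℂ n) :=
  (unitaryHaar n).map fun U : unitaryGroup n ℂ => toEuclideanCLM (𝕜 := ℂ) U.1 ψ

theorem continuous_toEuclideanCLM_unitaryGroup_apply (ψ : EuclideanSpace ℂ n) :
    Continuous fun U : unitaryGroup n ℂ => toEuclideanCLM (𝕜 := ℂ) U.1 ψ :=
  (PiLp.continuous_toLp 2 _).comp
    (Continuous.matrix_mulVec continuous_subtype_val continuous_const)

theorem integrable_unitaryHaar_of_continuous {f : unitaryGroup n ℂ → ℝ} (hf : Continuous f) :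
    Integrable f (unitaryHaar n) :=
  hf.integrable_of_hasCompactSupport (HasCompactSupport.of_compactSpace f)

theorem integral_haarOrbitMeasure (ψ : EuclideanSpace ℂ n) {f : EuclideanSpace ℂ n → ℝ}
    (hf : Continuous f) :
    ∫ v, f v ∂haarOrbitMeasure ψ =
      ∫ U : unitaryGroup n ℂ, f (toEuclideanCLM (𝕜 := ℂ) U.1 ψ) ∂unitaryHaar n :=
  integral_map (continuous_toEuclideanCLM_unitaryGroup_apply ψ).aemeasurable
    hf.aestronglyMeasurable

theorem integrable_haarOrbitMeasure (ψ : EuclideanSpace ℂ n) {f : EuclideanSpace ℂ n → ℝ}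
    (hf : Continuous f) : Integrable f (haarOrbitMeasure ψ) :=
  (integrable_map_measure hf.aestronglyMeasurable
    (continuous_toEuclideanCLM_unitaryGroup_apply ψ).aemeasurable).mpr
    (integrable_unitaryHaar_of_continuous
      (hf.comp (continuous_toEuclideanCLM_unitaryGroup_apply ψ)))

theorem isUnitarilyInvariant_haarOrbitMeasure (ψ : EuclideanSpace ℂ n) :
    IsUnitarilyInvariant (haarOrbitMeasure ψ) := fun V hV => by
  have hφ := (continuous_toEuclideanCLM_unitaryGroup_apply ψ).measurable
  refine ⟨(toEuclideanCLM (𝕜 := ℂ) V).measurable, ?_⟩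
  calc (haarOrbitMeasure ψ).map (toEuclideanCLM (𝕜 := ℂ) V)
      = ((unitaryHaar n).map (⟨V, hV⟩ * ·)).map
          fun U : unitaryGroup n ℂ => toEuclideanCLM (𝕜 := ℂ) U.1 ψ := by
        rw [haarOrbitMeasure, Measure.map_map (by fun_prop) hφ,
          Measure.map_map hφ (measurable_const_mul _)]
        congr 1
        ext U : 1
        simp
    _ = haarOrbitMeasure ψ := by rw [map_mul_left_eq_self, haarOrbitMeasure]

theorem integral_norm_pow_haarOrbitMeasure (ψ : EuclideanSpace ℂ n) (k : ℕ) :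
    ∫ v, ‖v‖ ^ k ∂haarOrbitMeasure ψ = ‖ψ‖ ^ k := by
  rw [integral_haarOrbitMeasure ψ (by fun_prop)]
  simp [norm_toEuclideanCLM_of_mem_unitaryGroup]

end HaarOrbit

section ReducedState

theorem mul_ketBra_mul_conjTranspose {n : Type} [Fintype n] [DecidableEq n] (V : Matrix n n ℂ)
    (ψ : EuclideanSpace ℂ n) :
    V * ketBra ψ * Vᴴ = ketBra (toEuclideanCLM (𝕜 := ℂ) V ψ) := by
  have hketBra (φ : EuclideanSpace ℂ n) : ketBra φ = vecMulVec φ.ofLp (star φ.ofLp) := rfl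
  rw [hketBra, hketBra, mul_vecMulVec, vecMulVec_mul, ← star_mulVec, ofLp_toEuclideanCLM]

/-- The partial trace over the second tensor factor of `ℂ^α ⊗ ℂ^β`, in the coordinates `α × β`. It
extends `partialTraceB` to factors of different dimensions. -/
def partialTraceRight {α β R : Type*} [Fintype β] [AddCommMonoid R]
    (ρ : Matrix (α × β) (α × β) R) : Matrix α α R :=
  Matrix.of fun i i' => ∑ j, ρ (i, j) (i', j)

variable {α β : Type} [Fintype α] [Fintype β] [DecidableEq α]

theorem trace_partialTraceRight_ketBra_sq (v : EuclideanSpace ℂ (α × β)) :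
    (partialTraceRight (ketBra v) ^ 2).trace =
      ∑ p : (α × β) × (α × β),
        v p.1 * v p.2 * star (v (p.2.1, p.1.2)) * star (v (p.1.1, p.2.2)) := by
  simp only [sq, trace, diag, mul_apply, partialTraceRight, ketBra, of_apply, Finset.sum_mul_sum,
    Fintype.sum_prod_type]
  refine Finset.sum_congr rfl fun i _ => ?_
  rw [Finset.sum_comm]
  exact Finset.sum_congr rfl fun j _ => Finset.sum_congr rfl fun i' _ =>
    Finset.sum_congr rfl fun j' _ => by ring

variable {μ : Measure (EuclideanSpace ℂ (α × β))}

theorem integrable_trace_partialTraceRight_ketBra_sq (hint : Integrable (fun v => ‖v‖ ^ 4) μ) :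
    Integrable (fun v => (partialTraceRight (ketBra v) ^ 2).trace) μ := by
  simp only [trace_partialTraceRight_ketBra_sq]
  exact integrable_finsetSum _ fun p _ => integrable_fourth_monomial hint ..

variable [DecidableEq β]

theorem sum_ite_fst_eq_add_ite_snd_eq :
    ∑ p : (α × β) × (α × β),
        ((if p.1.1 = p.2.1 then 1 else 0) + if p.1.2 = p.2.2 then 1 else 0 : ℂ) =
      Fintype.card α * Fintype.card β * (Fintype.card α + Fintype.card β) := by
  calc ∑ p : (α × β) × (α × β),
        ((if p.1.1 = p.2.1 then 1 else 0) + if p.1.2 = p.2.2 then 1 else 0 : ℂ)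
      = ∑ i : α, ∑ j : β, ∑ i' : α, ∑ j' : β,
          ((if i = i' then 1 else 0) + if j = j' then 1 else 0 : ℂ) := by
        simp only [Fintype.sum_prod_type]
    _ = Fintype.card α * Fintype.card β * (Fintype.card α + Fintype.card β) := by
        simp only [Finset.sum_add_distrib, Finset.sum_const, Finset.card_univ, nsmul_eq_mul,
          ← Finset.mul_sum, Finset.sum_ite_eq, Finset.mem_univ, if_true, mul_one]
        ring

theorem IsUnitarilyInvariant.integral_trace_partialTraceRight_ketBra_sq
    (hμ : IsUnitarilyInvariant μ) (hint : Integrable (fun v => ‖v‖ ^ 4) μ) :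
    ∫ v, (partialTraceRight (ketBra v) ^ 2).trace ∂μ =
      (((Fintype.card α + Fintype.card β) / (Fintype.card α * Fintype.card β + 1) *
        ∫ v, ‖v‖ ^ 4 ∂μ : ℝ) : ℂ) := by
  calc ∫ v, (partialTraceRight (ketBra v) ^ 2).trace ∂μ
      = ∑ p : (α × β) × (α × β), fourthMoment μ p.1 p.2 (p.2.1, p.1.2) (p.1.1, p.2.2) := by
        simp only [trace_partialTraceRight_ketBra_sq]
        exact integral_finsetSum _ fun p _ => integrable_fourth_monomial hint ..
    _ = ((∫ v, ‖v‖ ^ 4 ∂μ : ℝ) : ℂ) / (Fintype.card (α × β) * (Fintype.card (α × β) + 1)) *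
          (Fintype.card α * Fintype.card β * (Fintype.card α + Fintype.card β)) := by
        rw [← sum_ite_fst_eq_add_ite_snd_eq, Finset.mul_sum]
        refine Finset.sum_congr rfl fun ⟨⟨i, j⟩, i', j'⟩ _ => ?_
        have hfst : i = i' ∧ i' = i ↔ i = i' := and_iff_left_of_imp Eq.symm
        have hsnd : j = j' ∧ j' = j ↔ j = j' := and_iff_left_of_imp Eq.symm
        simp only [hμ.fourthMoment_eq hint, Prod.mk.injEq, and_true, true_and, hfst, hsnd]
    _ = _ := by
        push_cast [Fintype.card_prod]
        rcases isEmpty_or_nonempty (α × β) with _ | _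
        · simp [Subsingleton.elim _ (0 : EuclideanSpace ℂ (α × β))]
        · obtain ⟨_, _⟩ := nonempty_prod.mp ‹Nonempty (α × β)›
          have hα : (Fintype.card α : ℂ) ≠ 0 := Nat.cast_ne_zero.mpr Fintype.card_ne_zero
          have hβ : (Fintype.card β : ℂ) ≠ 0 := Nat.cast_ne_zero.mpr Fintype.card_ne_zero
          have hdim : (Fintype.card α * Fintype.card β + 1 : ℂ) ≠ 0 :=
            mod_cast (Fintype.card α * Fintype.card β).succ_ne_zero
          field_simp

theorem mainTheorem8_general (ψ : EuclideanSpace ℂ (α × β)) :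
    Integrable (fun U : unitaryGroup (α × β) ℂ =>
        (partialTraceRight ((U : Matrix (α × β) (α × β) ℂ) * ketBra ψ *
          (U : Matrix (α × β) (α × β) ℂ)ᴴ) ^ 2).trace.re) (unitaryHaar (α × β)) ∧
      ∫ U : unitaryGroup (α × β) ℂ,
          (partialTraceRight ((U : Matrix (α × β) (α × β) ℂ) * ketBra ψ *
            (U : Matrix (α × β) (α × β) ℂ)ᴴ) ^ 2).trace.re ∂unitaryHaar (α × β) =
        ((Fintype.card α : ℝ) + Fintype.card β) / ((Fintype.card α : ℝ) * Fintype.card β + 1) *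
          ‖ψ‖ ^ 4 := by
  have hint : Integrable (fun v => ‖v‖ ^ 4) (haarOrbitMeasure ψ) :=
    integrable_haarOrbitMeasure ψ (by fun_prop)
  have hcont : Continuous fun v : EuclideanSpace ℂ (α × β) =>
      (partialTraceRight (ketBra v) ^ 2).trace.re := by
    simp only [trace_partialTraceRight_ketBra_sq]
    fun_prop
  simp only [mul_ketBra_mul_conjTranspose]
  refine ⟨integrable_unitaryHaar_of_continuous
    (hcont.comp (continuous_toEuclideanCLM_unitaryGroup_apply ψ)), ?_⟩
  rw [← integral_haarOrbitMeasure ψ hcont]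
  calc ∫ v, (partialTraceRight (ketBra v) ^ 2).trace.re ∂haarOrbitMeasure ψ
      = (∫ v, (partialTraceRight (ketBra v) ^ 2).trace ∂haarOrbitMeasure ψ).re :=
        integral_re (integrable_trace_partialTraceRight_ketBra_sq hint)
    _ = _ := by
        rw [(isUnitarilyInvariant_haarOrbitMeasure ψ).integral_trace_partialTraceRight_ketBra_sq
          hint, integral_norm_pow_haarOrbitMeasure, Complex.ofReal_re]

end ReducedState

theorem mainTheorem8 (d : ℕ) (hd : IsPrimePow d)
    (ψ : EuclideanSpace ℂ (Fin d × Fin d)) (hψ : ‖ψ‖ = 1) :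
    Integrable
        (fun U : Matrix.unitaryGroup (Fin d × Fin d) ℂ =>
          purity (partialTraceB
            ((U : Matrix (Fin d × Fin d) (Fin d × Fin d) ℂ) * ketBra ψ *
              (U : Matrix (Fin d × Fin d) (Fin d × Fin d) ℂ).conjTranspose)))
        (unitaryHaar (Fin d × Fin d)) ∧
      ∫ U : Matrix.unitaryGroup (Fin d × Fin d) ℂ,
          purity (partialTraceB
            ((U : Matrix (Fin d × Fin d) (Fin d × Fin d) ℂ) * ketBra ψ *
              (U : Matrix (Fin d × Fin d) (Fin d × Fin d) ℂ).conjTranspose))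
          ∂(unitaryHaar (Fin d × Fin d)) =
        2 * (d : ℝ) / ((d : ℝ) ^ 2 + 1) := by
  have h := mainTheorem8_general ψ
  rwa [hψ, Fintype.card_fin, one_pow, mul_one, ← two_mul, ← sq] at h
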